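/- Let $p$ be a prime, let $P$ be a finite $p$-group, let $\mathcal F$ be a saturated fusion system on $P$, and let $\mathcal E$ be a normal subsystem of $\mathcal F$, on a subgroup $Q$ of $P$. This means that $Q$ is strongly $\mathcal F$-closed, that $\mathcal E$ is a saturated fusion system on $Q$ all of whose morphisms lie in $\mathcal F$, and that for all $A\le B\le Q$, $\phi\in\operatorname{Hom}_{\mathcal E}(A,B)$ and $\psi\in\operatorname{Hom}_{\mathcal F}(B,P)$ the homomorphism $\psi^{-1}\phi\psi$ (maps composed from left to right) lies in $\operatorname{Hom}_{\mathcal E}(A\psi,Q)$. For a fusion system $\mathcal G$ on a group $X$ and a subgroup $R\le X$, let $N_{\mathcal G}(R)$ be the system on $N_X(R)$ whose morphisms $A\to B$ (for $A,B\le N_X(R)$) are those $\phi\in\operatorname{Hom}_{\mathcal G}(A,B)$ that extend to some $\bar\phi\in\operatorname{Hom}_{\mathcal G}(RA,RB)$ which restricts to an automorphism of $R$. Suppose that $\mathcal E=N_{\mathcal E}(R)$ for some subgroup $R\le Q$, and let $S$ be the subgroup of $Q$ generated by all $\mathcal F$-conjugates of $R$, that is, by all subgroups of $P$ that are isomorphic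 to $R$ via an isomorphism in $\mathcal F$. Then $\mathcal F=N_{\mathcal F}(S)$. -/

import Mathlib

/-- The image `Aφ` of a homomorphism `φ : A → B` between subgroups of `G`, as a subgroup
of `G`. -/
def imageSubgroup {G : Type*} [Group G] {A B : Subgroup G} (φ : A →* B) :
    Subgroup G :=
  (B.subtype.comp φ).range

/-- The homomorphism `A → Aφ` obtained from `φ : A → B` by restricting the codomain. -/
def toImage {G : Type*} [Group G] {A B : Subgroup G} (φ : A →* B) :
    A →* imageSubgroup φ :=
  (B.subtype.comp φ).rangeRestrict

/-- A prefusion system on a subgroup `carrier` of `G`: for each pair of subgroups `A`, `B` of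
`carrier`, a set `Hom A B` of injective homomorphisms `A → B`. (For subgroups of `G` not
contained in `carrier` the set is empty.) -/
@[ext]
structure PrefusionSystem (G : Type*) [Group G] where
  carrier : Subgroup G
  Hom : ∀ A B : Subgroup G, Set (A →* B)
  le_carrier : ∀ {A B : Subgroup G} {φ : A →* B}, φ ∈ Hom A B → A ≤ carrier ∧ B ≤ carrier
  injective : ∀ {A B : Subgroup G} {φ : A →* B}, φ ∈ Hom A B → Function.Injective φ

/-- A fusion system on the group `carrier`. Conjugation by `g` is `θ_g : a ↦ g⁻¹ a g`. -/
structure FusionSystem (G : Type*) [Group G] extends PrefusionSystem G where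
  comp_mem : ∀ {A B C : Subgroup G} {φ : A →* B} {ψ : B →* C},
    φ ∈ Hom A B → ψ ∈ Hom B C → ψ.comp φ ∈ Hom A C
  conj_mem : ∀ {A B : Subgroup G}, A ≤ carrier → B ≤ carrier → ∀ g ∈ carrier,
    ∀ φ : A →* B, (∀ a : A, (φ a : G) = g⁻¹ * a * g) → φ ∈ Hom A B
  toImage_mem : ∀ {A B : Subgroup G} {φ : A →* B}, φ ∈ Hom A B →
    toImage φ ∈ Hom A (imageSubgroup φ)
  symm_mem : ∀ {A B : Subgroup G} (e : A ≃* B), e.toMonoidHom ∈ Hom A B →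
    e.symm.toMonoidHom ∈ Hom B A

namespace PrefusionSystem

variable {G : Type*} [Group G] (F : PrefusionSystem G)

/-- The normalizer `N_P(A)` of `A` in the group `P` on which `F` is defined. -/
def normalizerIn (A : Subgroup G) : Subgroup G :=
  F.carrier ⊓ Subgroup.normalizer (A : Set G)

/-- `A` and `B` are `F`-conjugate: there is an isomorphism `A → B` in `F`. -/
def IsConjugate (A B : Subgroup G) : Prop :=
  ∃ e : A ≃* B, e.toMonoidHom ∈ F.Hom A B

/-- The normalizer `N_F(R)`: its objects are the subgroups of `N_P(R)`, and its morphisms `A → B`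
are those morphisms `φ : A → B` of `F` that extend to a morphism `φ' : RA → RB` of `F` whose
restriction to `R` is an automorphism of `R`. -/
def normalizer (R : Subgroup G) : PrefusionSystem G where
  carrier := F.normalizerIn R
  Hom A B := {φ | A ≤ F.normalizerIn R ∧ B ≤ F.normalizerIn R ∧ φ ∈ F.Hom A B ∧
    ∃ φ' ∈ F.Hom (R ⊔ A) (R ⊔ B),
      (∀ a : A, (φ' (Subgroup.inclusion le_sup_right a) : G) = φ a) ∧
      ∃ κ : MulAut R, ∀ r : R, (φ' (Subgroup.inclusion le_sup_left r) : G) = κ r}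
  le_carrier h := ⟨h.1, h.2.1⟩
  injective h := F.injective h.2.2.1

/-- `A` is fully normalized: `|N_P(A)| ≥ |N_P(B)|` whenever `A → B` is an isomorphism in `F`. -/
def IsFullyNormalized (A : Subgroup G) : Prop :=
  ∀ B : Subgroup G, F.IsConjugate A B → Nat.card (F.normalizerIn B) ≤ Nat.card (F.normalizerIn A)

/-- `Q` is strongly `F`-closed: every morphism of `F` whose domain is a subgroup of `Q` has
image in `Q`. -/
def IsStronglyClosed (Q : Subgroup G) : Prop :=
  Q ≤ F.carrier ∧ ∀ (A B : Subgroup G), ∀ φ ∈ F.Hom A B, A ≤ Q → imageSubgroup φ ≤ Q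

/-- For a morphism `φ : A → B`, the subgroup `N_φ` of all `x ∈ N_P(A)` for which there is
`y ∈ N_P(Aφ)` with `(a^x)φ = (aφ)^y` for all `a ∈ A`, where `a^x = x⁻¹ a x`. -/
def extensionGroup {A B : Subgroup G} (φ : A →* B) : Subgroup G where
  carrier := {x | x ∈ F.normalizerIn A ∧ ∃ y ∈ F.normalizerIn (imageSubgroup φ),
    ∀ a b : A, (b : G) = x⁻¹ * a * x → (φ b : G) = y⁻¹ * φ a * y}
  one_mem' := by
    refine ⟨one_mem _, 1, one_mem _, fun a b h => ?_⟩
    have : b = a := Subtype.ext (by simpa using h)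
    simp [this]
  mul_mem' := by
    rintro x x' ⟨hx, y, hy, h⟩ ⟨hx', y', hy', h'⟩
    refine ⟨mul_mem hx hx', y * y', mul_mem hy hy', fun a b hab => ?_⟩
    have hc : x⁻¹ * (a : G) * x ∈ A :=
      (Subgroup.mem_normalizer_iff''.1 hx.2 a).1 a.2
    have h1 := h a ⟨_, hc⟩ rfl
    have h2 := h' ⟨_, hc⟩ b (by rw [hab]; group)
    rw [h2, h1]; group
  inv_mem' := by
    rintro x ⟨hx, y, hy, h⟩
    refine ⟨inv_mem hx, y⁻¹, inv_mem hy, fun a b hab => ?_⟩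
    have h1 := h b a (by rw [hab]; group)
    rw [h1]; group

end PrefusionSystem

namespace FusionSystem

variable {G : Type*} [Group G] (F : FusionSystem G)

/-- The group `Aut_F(A)`, for a subgroup `A` of the group on which `F` is defined. -/
def aut (A : Subgroup G) (hA : A ≤ F.carrier) : Subgroup (MulAut A) where
  carrier := {κ | κ.toMonoidHom ∈ F.Hom A A}
  one_mem' := F.conj_mem hA hA 1 (one_mem _) _ fun a => by simp
  mul_mem' h h' := F.comp_mem h' h
  inv_mem' h := F.symm_mem _ h

/-- `F` is saturated: `Aut_P(P)` is a Sylow `p`-subgroup of `Aut_F(P)`, and every morphism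
`φ : A → P` with fully normalized image extends to a morphism `N_φ → P`. -/
structure IsSaturated (p : ℕ) (F : FusionSystem G) : Prop where
  sylow : ∃ T : Sylow p (F.aut F.carrier le_rfl),
    (T : Subgroup (F.aut F.carrier le_rfl)).map (F.aut F.carrier le_rfl).subtype =
      (MulAut.conj : F.carrier →* MulAut F.carrier).range
  extension : ∀ (A : Subgroup G), ∀ φ ∈ F.Hom A F.carrier,
    F.IsFullyNormalized (imageSubgroup φ) →
    ∃ φ' ∈ F.Hom (F.extensionGroup φ) F.carrier,
      ∀ (a : G) (ha : a ∈ A) (ha' : a ∈ F.extensionGroup φ), φ' ⟨a, ha'⟩ = φ ⟨a, ha⟩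

/-- `E` is a subsystem of `F`. -/
def IsSubsystem (E F : FusionSystem G) : Prop :=
  E.carrier ≤ F.carrier ∧ ∀ A B : Subgroup G, E.Hom A B ⊆ F.Hom A B

/-- `E` is a normal subsystem of `F`: it is a subsystem on a strongly `F`-closed subgroup `Q`, it
is saturated, and it is `F`-invariant, i.e. for all `A ≤ B ≤ Q`, all `φ : A → B` in `E` and
all `ψ : B → P` in `F`, the homomorphism `χ = ψ⁻¹φψ : Aψ → Q` (maps composed from left to
right) lies in `E`. -/
structure IsNormalSubsystem (p : ℕ) (E F : FusionSystem G) : Prop where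
  isSubsystem : IsSubsystem E F
  isStronglyClosed : F.IsStronglyClosed E.carrier
  invariant : ∀ (A B : Subgroup G) (hAB : A ≤ B), B ≤ E.carrier →
    ∀ φ ∈ E.Hom A B, ∀ ψ ∈ F.Hom B F.carrier,
    ∃ χ ∈ E.Hom (imageSubgroup (ψ.comp (Subgroup.inclusion hAB))) E.carrier,
      ∀ a : A, (χ (toImage (ψ.comp (Subgroup.inclusion hAB)) a) : G) = ψ (φ a)
  isSaturated : E.IsSaturated p

end FusionSystem

/-! ### Isomorphisms of a fusion system, described by functions on the ambient group -/

namespace FusionSystem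

variable {G : Type*} [Group G]

/-- The function `f` restricts to an isomorphism `A → B` that lies in the fusion system `F`. -/
def IsIso (F : FusionSystem G) (A B : Subgroup G) (f : G → G) : Prop :=
  ∃ e : A ≃* B, e.toMonoidHom ∈ F.Hom A B ∧ ∀ a : A, (e a : G) = f a

theorem exists_isIso_of_mem {F : FusionSystem G} {A B : Subgroup G} {φ : A →* B}
    (h : φ ∈ F.Hom A B) :
    ∃ f : G → G, (∀ a : A, (φ a : G) = f a) ∧ F.IsIso A (imageSubgroup φ) f := by
  classical
  let f : G → G := fun x => if h : x ∈ A then φ ⟨x, h⟩ else 1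
  have hf : ∀ a : A, (φ a : G) = f a := fun a => by simp [f]
  have hb : Function.Bijective (toImage φ) := by
    refine ⟨F.injective (F.toImage_mem h), fun ⟨_, a, rfl⟩ => ⟨a, rfl⟩⟩
  exact ⟨f, hf, MulEquiv.ofBijective _ hb, F.toImage_mem h, hf⟩

theorem isIso_of_aut {F : FusionSystem G} {A : Subgroup G} {hA : A ≤ F.carrier} {u : MulAut A}
    (h : u ∈ F.aut A hA) : ∃ f : G → G, (∀ a : A, (u a : G) = f a) ∧ F.IsIso A A f := by
  obtain ⟨f, hf, -⟩ := exists_isIso_of_mem (show u.toMonoidHom ∈ F.Hom A A from h)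
  exact ⟨f, hf, u, h, hf⟩

theorem isIso_of_isConjugate {F : FusionSystem G} {A B : Subgroup G} (h : F.IsConjugate A B) :
    ∃ f : G → G, F.IsIso A B f := by
  obtain ⟨e, he⟩ := h
  obtain ⟨f, hf, -⟩ := exists_isIso_of_mem he
  exact ⟨f, e, he, hf⟩

namespace IsIso

variable {F : FusionSystem G} {A B C X Y : Subgroup G} {f g : G → G}

theorem le_left (h : F.IsIso A B f) : A ≤ F.carrier := (F.le_carrier h.choose_spec.1).1

theorem le_right (h : F.IsIso A B f) : B ≤ F.carrier := (F.le_carrier h.choose_spec.1).2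

theorem isConjugate (h : F.IsIso A B f) : F.IsConjugate A B := ⟨h.choose, h.choose_spec.1⟩

theorem card_eq (h : F.IsIso A B f) : Nat.card A = Nat.card B :=
  Nat.card_congr h.choose.toEquiv

theorem congr (h : F.IsIso A B f) (hfg : ∀ a ∈ A, f a = g a) : F.IsIso A B g := by
  obtain ⟨e, he, hf⟩ := h
  exact ⟨e, he, fun a => (hf a).trans (hfg a a.2)⟩

theorem mem (h : F.IsIso A B f) {a : G} (ha : a ∈ A) : f a ∈ B := by
  obtain ⟨e, -, hf⟩ := h
  exact hf ⟨a, ha⟩ ▸ (e ⟨a, ha⟩).2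

theorem map_mul (h : F.IsIso A B f) {a b : G} (ha : a ∈ A) (hb : b ∈ A) :
    f (a * b) = f a * f b := by
  obtain ⟨e, -, hf⟩ := h
  have := hf (⟨a, ha⟩ * ⟨b, hb⟩)
  rw [_root_.map_mul, Subgroup.coe_mul, hf, hf] at this
  exact this.symm

theorem map_inv (h : F.IsIso A B f) {a : G} (ha : a ∈ A) : f a⁻¹ = (f a)⁻¹ := by
  obtain ⟨e, -, hf⟩ := h
  have := hf (⟨a, ha⟩⁻¹)
  rw [_root_.map_inv, Subgroup.coe_inv, hf] at this
  exact this.symm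

theorem map_one (h : F.IsIso A B f) : f 1 = 1 := by
  obtain ⟨e, -, hf⟩ := h
  have := hf 1
  rw [_root_.map_one] at this
  exact this.symm

theorem map_conj (h : F.IsIso A B f) {x a : G} (hx : x ∈ A) (ha : a ∈ A) :
    f (x⁻¹ * a * x) = (f x)⁻¹ * f a * f x := by
  rw [h.map_mul (A.mul_mem (A.inv_mem hx) ha) hx, h.map_mul (A.inv_mem hx) ha, h.map_inv hx]

theorem injOn (h : F.IsIso A B f) {a b : G} (ha : a ∈ A) (hb : b ∈ A) (hab : f a = f b) :
    a = b := by
  obtain ⟨e, -, hf⟩ := h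
  have : e ⟨a, ha⟩ = e ⟨b, hb⟩ := Subtype.ext (by rw [hf, hf]; exact hab)
  exact congrArg Subtype.val (e.injective this)

theorem exists_eq (h : F.IsIso A B f) {b : G} (hb : b ∈ B) : ∃ a ∈ A, f a = b := by
  obtain ⟨e, -, hf⟩ := h
  refine ⟨e.symm ⟨b, hb⟩, (e.symm ⟨b, hb⟩).2, ?_⟩
  rw [← hf]; simp

theorem image_eq (h : F.IsIso A B f) : f '' (A : Set G) = B := by
  ext b
  exact ⟨fun ⟨_, ha, hb⟩ => hb ▸ h.mem ha, fun hb => h.exists_eq hb⟩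

theorem unique (h : F.IsIso A B f) (h' : F.IsIso A C g) (hfg : ∀ a ∈ A, f a = g a) : B = C :=
  SetLike.coe_injective ((h.congr hfg).image_eq.symm.trans h'.image_eq)

theorem comp (h : F.IsIso A B f) (h' : F.IsIso B C g) : F.IsIso A C (g ∘ f) := by
  obtain ⟨e, he, hf⟩ := h
  obtain ⟨e', he', hg⟩ := h'
  refine ⟨e.trans e', F.comp_mem he he', fun a => ?_⟩
  rw [MulEquiv.trans_apply, hg, hf]; rfl

theorem symm (h : F.IsIso A B f) :
    ∃ g, F.IsIso B A g ∧ (∀ a ∈ A, g (f a) = a) ∧ ∀ b ∈ B, f (g b) = b := by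
  obtain ⟨e, he, hf⟩ := h
  have hs := F.symm_mem e he
  obtain ⟨g, hg, -⟩ := exists_isIso_of_mem hs
  have hg' : ∀ b : B, (e.symm b : G) = g b := hg
  refine ⟨g, ⟨e.symm, hs, hg⟩, fun a ha => ?_, fun b hb => ?_⟩
  · have := hg' (e ⟨a, ha⟩)
    rw [hf, MulEquiv.symm_apply_apply] at this
    exact this.symm
  · have := hf (e.symm ⟨b, hb⟩)
    rw [hg', MulEquiv.apply_symm_apply] at this
    exact this.symm

/-- A homomorphism agreeing with `f` lies in the fusion system. -/
theorem hom_mem (h : F.IsIso A B f) (hBC : B ≤ C) (hC : C ≤ F.carrier) (φ : A →* C)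
    (hφ : ∀ a : A, (φ a : G) = f a) : φ ∈ F.Hom A C := by
  have hB := h.le_right
  obtain ⟨e, he, hf⟩ := h
  have : φ = (Subgroup.inclusion hBC).comp e.toMonoidHom := by
    ext a
    rw [hφ, ← hf]; rfl
  rw [this]
  exact F.comp_mem he (F.conj_mem hB hC 1 (one_mem _) _ fun a => by simp)

theorem exists_hom (h : F.IsIso A B f) (hBC : B ≤ C) (hC : C ≤ F.carrier) :
    ∃ φ ∈ F.Hom A C, ∀ a : A, (φ a : G) = f a := by
  have hf : ∀ a : A, ((Subgroup.inclusion hBC).comp h.choose.toMonoidHom a : G) = f a :=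
    h.choose_spec.2
  exact ⟨_, h.hom_mem hBC hC _ hf, hf⟩

theorem refl (hA : A ≤ F.carrier) : F.IsIso A A id :=
  ⟨MulEquiv.refl A, F.conj_mem hA hA 1 (one_mem _) _ fun a => by simp, fun _ => rfl⟩

theorem restrict (h : F.IsIso A B f) (hX : X ≤ A) : ∃ Y ≤ B, F.IsIso X Y f := by
  have hA := h.le_left
  obtain ⟨φ, hφ, hf⟩ := h.exists_hom le_rfl h.le_right
  have hm := F.comp_mem (F.conj_mem (hX.trans hA) hA 1 (one_mem _) (Subgroup.inclusion hX)
    fun a => by simp) hφ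
  obtain ⟨g, hg, hi⟩ := exists_isIso_of_mem hm
  have hfg : ∀ a ∈ X, g a = f a := fun a ha => by
    rw [← hg ⟨a, ha⟩, ← hf ⟨a, hX ha⟩]; rfl
  have hi' := hi.congr hfg
  refine ⟨_, fun b hb => ?_, hi'⟩
  obtain ⟨a, ha, rfl⟩ := hi'.exists_eq hb
  exact h.mem (hX ha)

theorem restrict_eq (h : F.IsIso A B f) (hX : X ≤ A) (hY : f '' X = (Y : Set G)) :
    F.IsIso X Y f := by
  obtain ⟨Y', -, h'⟩ := h.restrict hX
  rwa [show Y = Y' from SetLike.coe_injective (hY.symm.trans h'.image_eq)]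

theorem sup (h : F.IsIso A B f) {X' Y' : Subgroup G} (hX : X ≤ A) (hY : Y ≤ A)
    (hX' : F.IsIso X X' f) (hY' : F.IsIso Y Y' f) : F.IsIso (X ⊔ Y) (X' ⊔ Y') f := by
  obtain ⟨φ, -, hf⟩ := h.exists_hom le_rfl h.le_right
  have key : ∀ Z : Subgroup G, Z ≤ A →
      f '' Z = ((Z.subgroupOf A).map (B.subtype.comp φ) : Subgroup G) := by
    intro Z hZ
    ext b
    constructor
    · rintro ⟨a, ha, rfl⟩
      exact ⟨⟨a, hZ ha⟩, ha, hf ⟨a, hZ ha⟩⟩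
    · rintro ⟨a, ha, rfl⟩
      exact ⟨a, ha, (hf a).symm⟩
  refine h.restrict_eq (sup_le hX hY) ?_
  rw [key _ (sup_le hX hY), Subgroup.subgroupOf_sup hX hY, Subgroup.map_sup,
    SetLike.coe_injective ((key X hX).symm.trans hX'.image_eq),
    SetLike.coe_injective ((key Y hY).symm.trans hY'.image_eq)]

theorem conj (hA : A ≤ F.carrier) (hB : B ≤ F.carrier) {x : G} (hx : x ∈ F.carrier)
    (h : ∀ a, a ∈ A ↔ x⁻¹ * a * x ∈ B) : F.IsIso A B fun a => x⁻¹ * a * x := by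
  let e : A ≃* B :=
    { toFun := fun a => ⟨x⁻¹ * a * x, (h a).1 a.2⟩
      invFun := fun b => ⟨x * b * x⁻¹, (h _).2 (by
        have : x⁻¹ * (x * b * x⁻¹) * x = (b : G) := by group
        rw [this]; exact b.2)⟩
      left_inv := fun a => Subtype.ext (by simp only; group)
      right_inv := fun a => Subtype.ext (by simp only; group)
      map_mul' := fun a b => Subtype.ext (by simp only [Subgroup.coe_mul]; group) }
  exact ⟨e, F.conj_mem hA hB x hx _ fun a => rfl, fun a => rfl⟩

theorem eq_of_le (h : F.IsIso A B f) [Finite A] (hBA : B ≤ A) : B = A := by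
  exact SetLike.coe_injective (Set.eq_of_subset_of_ncard_le hBA h.card_eq.le (Set.toFinite _))

end IsIso

theorem IsSubsystem.isIso {E F : FusionSystem G} (h : IsSubsystem E F) {A B : Subgroup G}
    {f : G → G} (hf : E.IsIso A B f) : F.IsIso A B f :=
  ⟨hf.choose, h.2 _ _ hf.choose_spec.1, hf.choose_spec.2⟩

theorem isStronglyClosed_iff {F : FusionSystem G} {Q : Subgroup G} :
    F.IsStronglyClosed Q ↔ Q ≤ F.carrier ∧ ∀ A B f, F.IsIso A B f → A ≤ Q → B ≤ Q := by
  refine and_congr_right fun _ => ⟨fun h A B f hf hA => ?_, fun h A B φ hφ hA => ?_⟩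
  · obtain ⟨φ, hφ, hφf⟩ := hf.exists_hom le_rfl hf.le_right
    intro b hb
    obtain ⟨a, ha, rfl⟩ := hf.exists_eq hb
    exact h A B φ hφ hA ⟨⟨a, ha⟩, hφf ⟨a, ha⟩⟩
  · obtain ⟨f, -, hf⟩ := exists_isIso_of_mem hφ
    exact h _ _ f hf hA

theorem _root_.PrefusionSystem.IsStronglyClosed.mem {F : FusionSystem G} {Q A B : Subgroup G} {f : G → G}
    (hQ : F.IsStronglyClosed Q) (hf : F.IsIso A B f) {a : G} (ha : a ∈ A) (haQ : a ∈ Q) :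
    f a ∈ Q := by
  obtain ⟨Y, -, h⟩ := hf.restrict (X := A ⊓ Q) inf_le_left
  exact (isStronglyClosed_iff.1 hQ).2 _ _ _ h inf_le_right (h.mem ⟨ha, haQ⟩)

theorem _root_.PrefusionSystem.IsStronglyClosed.le_normalizer {F : FusionSystem G} {Q : Subgroup G}
    (hQ : F.IsStronglyClosed Q) : F.carrier ≤ Subgroup.normalizer (Q : Set G) := by
  have key : ∀ x ∈ F.carrier, ∀ a ∈ Q, x⁻¹ * a * x ∈ Q := fun x hx a ha =>
    hQ.mem (IsIso.conj le_rfl le_rfl hx fun b =>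
      ⟨fun hb => mul_mem (mul_mem (inv_mem hx) hb) hx, fun hb => by
        have : b = x * (x⁻¹ * b * x) * x⁻¹ := by group
        rw [this]; exact mul_mem (mul_mem hx hb) (inv_mem hx)⟩) (hQ.1 ha) ha
  intro x hx
  refine Subgroup.mem_normalizer_iff''.2 fun a => ⟨key x hx a, fun h => ?_⟩
  have := key _ (inv_mem hx) _ h
  rwa [show x⁻¹⁻¹ * (x⁻¹ * a * x) * x⁻¹ = a by group] at this

/-- A morphism with fully normalized image extends to every subgroup of `N_φ`. -/
theorem IsSaturated.exists_extension_sup {p : ℕ} {F : FusionSystem G} (hF : F.IsSaturated p)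
    {A B N : Subgroup G} {f : G → G} (hf : F.IsIso A B f) (hB : F.IsFullyNormalized B)
    (hN : N ≤ F.normalizerIn A)
    (h : ∀ x ∈ N, ∃ y ∈ F.normalizerIn B, ∀ a ∈ A, f (x⁻¹ * a * x) = y⁻¹ * f a * y) :
    ∃ g C, F.IsIso (A ⊔ N) C g ∧ ∀ a ∈ A, g a = f a := by
  obtain ⟨φ, hφ, hφf⟩ := hf.exists_hom hf.le_right le_rfl
  have himg : imageSubgroup φ = B := by
    refine SetLike.coe_injective ?_
    rw [← hf.image_eq]
    ext b
    exact ⟨fun ⟨a, ha⟩ => ⟨a, a.2, (hφf a).symm.trans ha⟩,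
      fun ⟨a, ha, hb⟩ => ⟨⟨a, ha⟩, (hφf _).trans hb⟩⟩
  obtain ⟨φ', hφ', hext⟩ := hF.extension A φ hφ (himg ▸ hB)
  have hle : A ⊔ N ≤ F.extensionGroup φ := by
    refine sup_le (fun x hx => ?_) fun x hx => ?_
    · refine ⟨⟨hf.le_left hx, Subgroup.le_normalizer hx⟩, f x, himg ▸ ⟨hf.le_right (hf.mem hx),
        Subgroup.le_normalizer (hf.mem hx)⟩, fun a b hab => ?_⟩
      rw [hφf, hφf, hab, hf.map_conj hx a.2]
    · obtain ⟨y, hy, hxy⟩ := h x hx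
      refine ⟨hN hx, y, himg ▸ hy, fun a b hab => ?_⟩
      rw [hφf, hφf, hab, hxy a a.2]
  obtain ⟨g, hg, hi⟩ := exists_isIso_of_mem hφ'
  obtain ⟨C, -, hC⟩ := hi.restrict hle
  refine ⟨g, C, hC, fun a ha => ?_⟩
  rw [← hφf ⟨a, ha⟩, ← hext a ha (hle (Subgroup.mem_sup_left ha)), hg]

theorem IsSaturated.exists_extension {p : ℕ} {F : FusionSystem G} (hF : F.IsSaturated p)
    {A B N : Subgroup G} {f : G → G} (hf : F.IsIso A B f) (hB : F.IsFullyNormalized B)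
    (hAN : A ≤ N) (hN : N ≤ F.normalizerIn A)
    (h : ∀ x ∈ N, ∃ y ∈ F.normalizerIn B, ∀ a ∈ A, f (x⁻¹ * a * x) = y⁻¹ * f a * y) :
    ∃ g C, F.IsIso N C g ∧ ∀ a ∈ A, g a = f a := by
  have := hF.exists_extension_sup hf hB hN h
  rwa [sup_eq_right.2 hAN] at this

end FusionSystem

/-! ### Sylow theory inside finite groups -/

section GroupTheory

variable {X : Type*} [Group X] {p : ℕ} [Fact p.Prime]

theorem Subgroup.le_of_forall_mem_normalizer {P A B : Subgroup X} [Finite P] (hP : IsPGroup p P)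
    (hB : B ≤ P) (hAB : A ≤ B)
    (h : ∀ x ∈ B, x ∈ Subgroup.normalizer (A : Set X) → x ∈ A) : B ≤ A := by
  have hBp : IsPGroup p B := hP.to_le hB
  have : Finite B := Finite.of_injective _ (Subgroup.inclusion_injective hB)
  have := hBp.isNilpotent
  have hn := normalizerCondition_iff_only_full_group_self_normalizing.1
    (Group.normalizerCondition_of_isNilpotent (G := B)) (A.subgroupOf B) ?_
  · exact Subgroup.subgroupOf_eq_top.1 hn
  · refine le_antisymm (fun x hx => ?_) Subgroup.le_normalizer
    refine h x x.2 (Subgroup.mem_normalizer_iff.2 fun a => ⟨fun ha => ?_, fun ha => ?_⟩)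
    · exact (Subgroup.mem_normalizer_iff.1 hx ⟨a, hAB ha⟩).1 ha
    · have hb : a ∈ B := by
        have := B.mul_mem (B.mul_mem (B.inv_mem x.2) (hAB ha)) x.2
        rwa [show (x : X)⁻¹ * (x * a * (x : X)⁻¹) * x = a by group] at this
      exact (Subgroup.mem_normalizer_iff.1 hx ⟨a, hb⟩).2 ha

/-- Every `p`-subgroup of `Γ` is `Γ`-conjugate to a subgroup of `T`. -/
def ContainsConjugates (p : ℕ) (T Γ : Subgroup X) : Prop :=
  ∀ H ≤ Γ, IsPGroup p H → ∃ g ∈ Γ, ∀ h ∈ H, g * h * g⁻¹ ∈ T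

theorem containsConjugates_of_sylow [Finite X] {Γ : Subgroup X} (S : Sylow p Γ) :
    ContainsConjugates p ((S : Subgroup Γ).map Γ.subtype) Γ := by
  intro H hH hHp
  obtain ⟨S', hS'⟩ := (hHp.comap_of_injective Γ.subtype Γ.subtype_injective :
    IsPGroup p (H.subgroupOf Γ)).exists_le_sylow
  obtain ⟨g, hg⟩ := MulAction.exists_smul_eq Γ S' S
  refine ⟨g, g.2, fun h hh => ⟨g * ⟨h, hH hh⟩ * g⁻¹, ?_, rfl⟩⟩
  rw [← hg, Sylow.coe_subgroup_smul]
  exact Subgroup.smul_mem_pointwise_smul _ (MulAut.conj g) _ (hS' hh)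

/-- A `p`-subgroup `T` of `Γ` containing all `p`-elements of its normalizer is a Sylow subgroup. -/
theorem containsConjugates_of_normalizer [Finite X] {T Γ : Subgroup X} (hT : T ≤ Γ)
    (hTp : IsPGroup p T)
    (h : ∀ u ∈ Γ, (∃ n : ℕ, u ^ p ^ n = 1) → u ∈ Subgroup.normalizer (T : Set X) → u ∈ T) :
    ContainsConjugates p T Γ := by
  obtain ⟨S, hS⟩ := (hTp.comap_of_injective Γ.subtype Γ.subtype_injective :
    IsPGroup p (T.subgroupOf Γ)).exists_le_sylow
  have hSp : IsPGroup p ((S : Subgroup Γ).map Γ.subtype) := S.2.map _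
  have hTS : T ≤ (S : Subgroup Γ).map Γ.subtype := fun t ht => ⟨⟨t, hT ht⟩, hS ht, rfl⟩
  have hle : (S : Subgroup Γ).map Γ.subtype ≤ T :=
    Subgroup.le_of_forall_mem_normalizer hSp le_rfl hTS fun u hu hn => by
      refine h u (Subgroup.map_subtype_le _ hu) ?_ hn
      obtain ⟨n, hn⟩ := hSp ⟨u, hu⟩
      exact ⟨n, congrArg Subtype.val hn⟩
  rw [le_antisymm hTS hle]
  exact containsConjugates_of_sylow S

theorem ContainsConjugates.inf [Finite X] {T Γ M : Subgroup X} (hTΓ : ContainsConjugates p T Γ)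
    (hT : IsPGroup p T) (hM : M ≤ Γ) (hn : ∀ g ∈ Γ, ∀ m ∈ M, g * m * g⁻¹ ∈ M) :
    ContainsConjugates p (T ⊓ M) M := by
  obtain ⟨S, hS⟩ := ((hT.to_le inf_le_left).comap_of_injective M.subtype M.subtype_injective :
    IsPGroup p ((T ⊓ M).subgroupOf M)).exists_le_sylow
  have hTS : T ⊓ M ≤ (S : Subgroup M).map M.subtype := fun t ht => ⟨⟨t, ht.2⟩, hS ht, rfl⟩
  obtain ⟨g, hg, hgS⟩ := hTΓ _ ((Subgroup.map_subtype_le (S : Subgroup M)).trans hM) (S.2.map _)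
  have hle : ((S : Subgroup M).map M.subtype).map (MulAut.conj g).toMonoidHom ≤ T ⊓ M := by
    rintro _ ⟨s, hs, rfl⟩
    exact ⟨hgS s hs, hn g hg s (Subgroup.map_subtype_le _ hs)⟩
  have hcard : Nat.card ((S : Subgroup M).map M.subtype) ≤ Nat.card ↥(T ⊓ M) := by
    rw [← Subgroup.card_map_of_injective (f := (MulAut.conj g).toMonoidHom) (MulAut.conj g).injective]
    exact Subgroup.card_le_of_le hle
  rw [Subgroup.eq_of_le_of_card_ge hTS hcard]
  exact containsConjugates_of_sylow S

theorem Subgroup.mem_of_pow_mem_of_coprime {H : Subgroup X} {u : X} {m n : ℕ} (hmn : m.Coprime n)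
    (hm : u ^ m ∈ H) (hn : u ^ n ∈ H) : u ∈ H := by
  have := Nat.gcd_eq_gcd_ab m n
  rw [hmn.gcd_eq_one] at this
  rw [← zpow_one u, show (1 : ℤ) = _ from this, zpow_add, zpow_mul, zpow_mul]
  exact H.mul_mem (H.zpow_mem (by simpa using hm) _) (H.zpow_mem (by simpa using hn) _)

end GroupTheory

/-! ### Automizers of fully normalized subgroups -/

namespace FusionSystem

variable {G : Type*} [Group G] {p : ℕ} {F : FusionSystem G} {A B : Subgroup G} {f : G → G}

theorem finite_of_le [Finite F.carrier] (hA : A ≤ F.carrier) : Finite A :=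
  Finite.of_injective _ (Subgroup.inclusion_injective hA)

theorem _root_.Subgroup.mem_normalizer_of_forall_conj_mem [Finite A] {x : G}
    (h : ∀ a ∈ A, x⁻¹ * a * x ∈ A) : x ∈ Subgroup.normalizer (A : Set G) := by
  have : Finite ((A : Set G) : Type _) := ‹Finite A›
  rw [← inv_mem_iff]
  exact Subgroup.mem_normalizer_fintype fun a ha => by simpa using h a ha

/-- The group `Aut_P(A)` of automorphisms of `A` induced by conjugation in `P`. -/
noncomputable def autBy (F : FusionSystem G) (A : Subgroup G) : Subgroup (MulAut A) :=
  (F.carrier.subgroupOf (Subgroup.normalizer (A : Set G))).map A.normalizerMonoidHom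

theorem mem_autBy {u : MulAut A} :
    u ∈ F.autBy A ↔ ∃ x ∈ F.normalizerIn A, ∀ a : A, (u a : G) = x⁻¹ * a * x := by
  constructor
  · rintro ⟨x, hx, rfl⟩
    refine ⟨(x : G)⁻¹, ⟨Subgroup.inv_mem _ hx, Subgroup.inv_mem _ x.2⟩, fun a => ?_⟩
    simp
  · rintro ⟨x, hx, h⟩
    refine ⟨⟨x⁻¹, Subgroup.inv_mem _ hx.2⟩, Subgroup.inv_mem _ hx.1, ?_⟩
    ext a
    rw [h]
    simp

theorem isPGroup_autBy (hP : IsPGroup p F.carrier) : IsPGroup p (F.autBy A) :=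
  (hP.comap_of_injective _ (Subgroup.subtype_injective _) :
    IsPGroup p (F.carrier.subgroupOf (Subgroup.normalizer (A : Set G)))).map _

theorem autBy_le_aut (hA : A ≤ F.carrier) : F.autBy A ≤ F.aut A hA := by
  intro u hu
  obtain ⟨x, hx, h⟩ := mem_autBy.1 hu
  exact F.conj_mem hA hA x hx.1 _ h

theorem isConjugate_trans {C : Subgroup G} (h : F.IsConjugate A B) (h' : F.IsConjugate B C) :
    F.IsConjugate A C :=
  ⟨h.choose.trans h'.choose, F.comp_mem h.choose_spec h'.choose_spec⟩

theorem exists_isFullyNormalized [Finite F.carrier] (hA : A ≤ F.carrier) :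
    ∃ B f, F.IsIso A B f ∧ F.IsFullyNormalized B := by
  let s : Set ℕ := {n | ∃ B, F.IsConjugate A B ∧ Nat.card (F.normalizerIn B) = n}
  have hs : s.Nonempty := ⟨_, A, (IsIso.refl hA).isConjugate, rfl⟩
  have hb : BddAbove s := by
    refine ⟨Nat.card F.carrier, ?_⟩
    rintro _ ⟨B, -, rfl⟩
    exact Subgroup.card_le_of_le inf_le_left
  obtain ⟨B, hB, hn⟩ := Nat.sSup_mem hs hb
  obtain ⟨f, hf⟩ := isIso_of_isConjugate hB
  refine ⟨B, f, hf, fun C hC => ?_⟩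
  rw [hn]
  exact le_csSup hb ⟨C, isConjugate_trans hB hC, rfl⟩

theorem exists_conj_mem {Γ T : Subgroup (MulAut B)} (h : ContainsConjugates p T Γ)
    (hT : T ≤ F.autBy B) (e : A ≃* B) {H : Subgroup (MulAut A)} (hHp : IsPGroup p H)
    (hH : H.map (MulAut.congr e).toMonoidHom ≤ Γ) :
    ∃ γ ∈ Γ, ∀ u ∈ H, ∃ y ∈ F.normalizerIn B,
      ∀ a : A, (γ (e (u a)) : G) = y⁻¹ * γ (e a) * y := by
  obtain ⟨γ, hγ, hγH⟩ := h _ hH (hHp.map _)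
  refine ⟨γ, hγ, fun u hu => ?_⟩
  obtain ⟨y, hy, hyu⟩ := mem_autBy.1 (hT (hγH _ ⟨u, hu, rfl⟩))
  refine ⟨y, hy, fun a => ?_⟩
  rw [← hyu]
  simp [MulAut.mul_apply, MulAut.congr]

theorem IsIso.exists_conj_mem (hf : F.IsIso A B f)
    (h : ContainsConjugates p (F.autBy B) (F.aut B hf.le_right)) {H : Subgroup (MulAut A)}
    (hH : H ≤ F.aut A hf.le_left) (hHp : IsPGroup p H) :
    ∃ g, F.IsIso A B g ∧ ∀ u ∈ H, ∃ y ∈ F.normalizerIn B,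
      ∀ a : A, g (u a) = y⁻¹ * g a * y := by
  obtain ⟨e, he, hef⟩ := id hf
  obtain ⟨γ, hγ, hγH⟩ := FusionSystem.exists_conj_mem h le_rfl e hHp (by
    rintro _ ⟨u, hu, rfl⟩
    exact F.comp_mem (F.symm_mem e he) (F.comp_mem (hH hu) he))
  obtain ⟨k, hk, hki⟩ := isIso_of_aut hγ
  refine ⟨k ∘ f, hf.comp hki, fun u hu => ?_⟩
  obtain ⟨y, hy, hyu⟩ := hγH u hu
  refine ⟨y, hy, fun a => ?_⟩
  have := hyu a
  rwa [hk, hk, hef, hef] at this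

theorem IsIso.mem_normalizer [Finite A] {N C : Subgroup G} {g : G → G} (hg : F.IsIso N C g)
    (hAN : A ≤ N) (hf : F.IsIso A B g) {x : G} (hx : x ∈ N)
    (hxA : x ∈ Subgroup.normalizer (A : Set G)) : g x ∈ F.normalizerIn B := by
  have : Finite B := Finite.of_equiv _ hf.choose.toEquiv
  refine ⟨hg.le_right (hg.mem hx), Subgroup.mem_normalizer_of_forall_conj_mem fun b hb => ?_⟩
  obtain ⟨a, ha, rfl⟩ := hf.exists_eq hb
  rw [← hg.map_conj hx (hAN ha)]
  exact hf.mem ((Subgroup.mem_normalizer_iff''.1 hxA a).1 ha)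

variable [Fact p.Prime] [Finite F.carrier]

theorem mem_autBy_of_mem_normalizer (hF : F.IsSaturated p) (hA : A ≤ F.carrier)
    (hfn : F.IsFullyNormalized A)
    (ih : ∀ B : Subgroup G, F.IsFullyNormalized B → Nat.card A < Nat.card B →
      ∀ hB : B ≤ F.carrier, ContainsConjugates p (F.autBy B) (F.aut B hB))
    (hlt : Nat.card A < Nat.card (F.normalizerIn A)) {u : MulAut A} (hu : u ∈ F.aut A hA)
    (hup : ∃ n : ℕ, u ^ p ^ n = 1)
    (hun : u ∈ Subgroup.normalizer (F.autBy A : Set (MulAut A))) : u ∈ F.autBy A := by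
  have hAN : A ≤ F.normalizerIn A := le_inf hA Subgroup.le_normalizer
  have : Finite A := finite_of_le hA
  have hNc : F.normalizerIn A ≤ F.carrier := inf_le_left
  have : Finite (F.normalizerIn A) := finite_of_le hNc
  obtain ⟨f, huf, hf⟩ := isIso_of_aut hu
  obtain ⟨g, C, hg, hgf⟩ := hF.exists_extension hf hfn hAN le_rfl fun x hx => by
    have hc : A.normalizerMonoidHom ⟨x⁻¹, Subgroup.inv_mem _ hx.2⟩ ∈ F.autBy A :=
      ⟨⟨x⁻¹, _⟩, Subgroup.inv_mem _ hx.1, rfl⟩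
    obtain ⟨y, hy, hxy⟩ := mem_autBy.1 ((Subgroup.mem_normalizer_iff.1 hun _).1 hc)
    refine ⟨y, hy, fun a ha => ?_⟩
    have := hxy (u ⟨a, ha⟩)
    simp only [MulAut.mul_apply, MulAut.inv_apply_self] at this
    rw [huf, huf] at this
    simpa using this
  have hgA : F.IsIso A A g := hf.congr fun a ha => (hgf a ha).symm
  obtain rfl : C = F.normalizerIn A := hg.eq_of_le fun b hb => by
    obtain ⟨x, hx, rfl⟩ := hg.exists_eq hb
    exact hg.mem_normalizer hAN hgA hx hx.2
  obtain ⟨v, hv, hvg⟩ := id hg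
  have hpow : ∀ (j : ℕ) (a : A), ((v ^ j) (Subgroup.inclusion hAN a) : G) = (u ^ j) a := by
    intro j
    induction j with
    | zero => intro a; simp
    | succ j ih =>
      intro a
      have : v (Subgroup.inclusion hAN a) = Subgroup.inclusion hAN (u a) :=
        Subtype.ext ((hvg _).trans ((hgf a a.2).trans (huf a).symm))
      rw [pow_succ, pow_succ, MulAut.mul_apply, MulAut.mul_apply, this, ih]
  obtain ⟨k, m, hm, hkm⟩ := Nat.exists_eq_pow_mul_and_not_dvd (orderOf_pos v).ne' p
    (Fact.out : p.Prime).ne_one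
  obtain ⟨n, hn⟩ := hup
  refine Subgroup.mem_of_pow_mem_of_coprime (m := m) (n := p ^ n)
    (Nat.Coprime.pow_right n (((Fact.out : p.Prime).coprime_iff_not_dvd.2 hm).symm)) ?_
    (hn ▸ one_mem _)
  obtain ⟨N', t, ht, hN'⟩ := exists_isFullyNormalized hNc
  obtain ⟨s, hs, hsv⟩ := ht.exists_conj_mem (ih N' hN' (ht.card_eq ▸ hlt) ht.le_right)
    (H := Subgroup.zpowers (v ^ m))
    (by rw [Subgroup.zpowers_le]; exact pow_mem (show v ∈ F.aut _ hNc from hv) m) (by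
      rintro ⟨_, j, rfl⟩
      refine ⟨k, Subtype.ext ?_⟩
      simp only [Subgroup.coe_pow, Subgroup.coe_one]
      rw [← zpow_natCast, zpow_comm, zpow_natCast, ← pow_mul, mul_comm m, ← hkm,
        pow_orderOf_eq_one, one_zpow])
  obtain ⟨y, hy, hyv⟩ := hsv _ (Subgroup.mem_zpowers _)
  obtain ⟨A', -, hA'⟩ := hs.restrict hAN
  have : Finite A' := finite_of_le hA'.le_right
  have hyv' : ∀ a : A, s ((u ^ m) a) = y⁻¹ * s a * y := fun a => by
    rw [← hpow]; exact hyv _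
  have hyA' : y ∈ F.normalizerIn A' := by
    refine ⟨hy.1, Subgroup.mem_normalizer_of_forall_conj_mem fun b hb => ?_⟩
    obtain ⟨a, ha, rfl⟩ := hA'.exists_eq hb
    rw [← hyv' ⟨a, ha⟩]
    exact hA'.mem (Subtype.prop _)
  have : Finite (F.normalizerIn A') := finite_of_le inf_le_left
  have hNN : N' = F.normalizerIn A' := by
    refine Subgroup.eq_of_le_of_card_ge (fun b hb => ?_) ?_
    · obtain ⟨x, hx, rfl⟩ := hs.exists_eq hb
      exact hs.mem_normalizer hAN hA' hx hx.2
    · exact (hfn A' hA'.isConjugate).trans hs.card_eq.le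
  obtain ⟨x, hx, rfl⟩ := hs.exists_eq (hNN ▸ hyA' : y ∈ N')
  refine mem_autBy.2 ⟨x, hx, fun a => ?_⟩
  refine hs.injOn (hAN (Subtype.prop _)) (mul_mem (mul_mem (inv_mem hx) (hAN a.2)) hx) ?_
  rw [hyv', hs.map_conj hx (hAN a.2)]

theorem containsConjugates_autBy (hP : IsPGroup p F.carrier) (hF : F.IsSaturated p)
    (hfn : F.IsFullyNormalized A) (hA : A ≤ F.carrier) :
    ContainsConjugates p (F.autBy A) (F.aut A hA) := by
  induction hn : Nat.card F.carrier - Nat.card A using Nat.strong_induction_on generalizing A with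
  | _ n ih =>
  subst hn
  have : Finite A := finite_of_le hA
  by_cases hAc : A = F.carrier
  · subst hAc
    obtain ⟨T, hT⟩ := hF.sylow
    have : F.autBy F.carrier = (T : Subgroup _).map (F.aut F.carrier le_rfl).subtype := by
      rw [hT]
      ext u
      rw [mem_autBy]
      constructor
      · rintro ⟨x, hx, h⟩
        refine ⟨⟨x⁻¹, inv_mem hx.1⟩, ?_⟩
        ext a
        rw [h]; simp
      · rintro ⟨x, rfl⟩
        refine ⟨(x : G)⁻¹, ⟨Subgroup.inv_mem _ x.2, Subgroup.inv_mem _ (Subgroup.le_normalizer x.2)⟩, fun a => ?_⟩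
        simp
    rw [this]
    exact containsConjugates_of_sylow T
  · have hlt : Nat.card A < Nat.card (F.normalizerIn A) := by
      have hle : A ≤ F.normalizerIn A := le_inf hA Subgroup.le_normalizer
      have : Finite (F.normalizerIn A) := finite_of_le inf_le_left
      by_contra hcon
      have heq := Subgroup.eq_of_le_of_card_ge hle (not_lt.1 hcon)
      refine hAc (le_antisymm hA (Subgroup.le_of_forall_mem_normalizer hP le_rfl hA
        fun x hx hxn => ?_))
      rw [heq]
      exact ⟨hx, hxn⟩
    refine containsConjugates_of_normalizer (autBy_le_aut hA) (isPGroup_autBy hP)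
      fun u hu hup hun => mem_autBy_of_mem_normalizer hF hA hfn
        (fun B hB hAB hBc => ih _ ?_ hB hBc rfl) hlt hu hup hun
    have := Subgroup.card_le_of_le hBc
    omega

end FusionSystem

/-! ### The Frattini condition for a normal subsystem -/

namespace FusionSystem

variable {G : Type*} [Group G] {p : ℕ} {E F : FusionSystem G} {A B C : Subgroup G} {f g h : G → G}

theorem IsNormalSubsystem.le_carrier (hE : IsNormalSubsystem p E F) : E.carrier ≤ F.carrier :=
  hE.isSubsystem.1

theorem IsNormalSubsystem.le_of_isIso (hE : IsNormalSubsystem p E F) (hf : F.IsIso A B f)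
    (hA : A ≤ E.carrier) : B ≤ E.carrier :=
  (isStronglyClosed_iff.1 hE.isStronglyClosed).2 _ _ _ hf hA

/-- Conjugation by isomorphisms of `F` preserves the morphisms of a normal subsystem. -/
theorem IsNormalSubsystem.conj_isIso (hE : IsNormalSubsystem p E F) {A' A₁ A₁' : Subgroup G}
    (hf : E.IsIso A A' f) (hg : F.IsIso B C g) (hB : B ≤ E.carrier) (hA : A ≤ B) (hA' : A' ≤ B)
    (h₁ : F.IsIso A A₁ g) (h₁' : F.IsIso A' A₁' g) (hh : ∀ a ∈ A, h (g a) = g (f a)) :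
    E.IsIso A₁ A₁' h := by
  obtain ⟨φ, hφ, hφf⟩ := hf.exists_hom hA' hB
  obtain ⟨ψ, hψ, hψg⟩ := hg.exists_hom hg.le_right le_rfl
  obtain ⟨χ, hχ, hχψ⟩ := hE.invariant A B hA hB φ hφ ψ hψ
  have hval : ∀ a : A, ((toImage (ψ.comp (Subgroup.inclusion hA)) a :
      imageSubgroup (ψ.comp (Subgroup.inclusion hA))) : G) = g a := fun a => hψg _
  have himg : imageSubgroup (ψ.comp (Subgroup.inclusion hA)) = A₁ := by
    refine SetLike.coe_injective ?_
    rw [← h₁.image_eq]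
    ext b
    exact ⟨fun ⟨a, ha⟩ => ⟨a, a.2, (hψg _).symm.trans ha⟩,
      fun ⟨a, ha, hb⟩ => ⟨⟨a, ha⟩, (hψg _).trans hb⟩⟩
  obtain ⟨k, hk, hki⟩ := exists_isIso_of_mem hχ
  have hkg : ∀ a ∈ A, k (g a) = g (f a) := fun a ha => by
    have := hχψ ⟨a, ha⟩
    rw [hk, hval, hψg, hφf] at this
    exact this
  generalize imageSubgroup χ = D at hki
  rw [himg] at hki
  have hD : D = A₁' := by
    refine SetLike.coe_injective ?_
    rw [← hki.image_eq, ← h₁'.image_eq, ← h₁.image_eq, ← hf.image_eq, Set.image_image,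
      Set.image_image]
    exact Set.image_congr hkg
  subst hD
  refine hki.congr fun b hb => ?_
  obtain ⟨a, ha, rfl⟩ := h₁.exists_eq hb
  rw [hkg a ha, hh a ha]

/-- The map `f` on `A` is an automorphism of `E.carrier` in `F` followed by an isomorphism
in `E`. -/
def Factors (E F : FusionSystem G) (A B : Subgroup G) (f : G → G) : Prop :=
  ∃ α β A', F.IsIso E.carrier E.carrier α ∧ F.IsIso A A' α ∧ E.IsIso A' B β ∧
    ∀ a ∈ A, β (α a) = f a

theorem IsNormalSubsystem.factors_of_comp (hE : IsNormalSubsystem p E F) (hA : A ≤ E.carrier)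
    (hf : F.IsIso A B f) (hgf : Factors E F A C (g ∘ f))
    (hgB : Factors E F B C g) : Factors E F A B f := by
  obtain ⟨α₁, β₁, A₁, hα₁, hAα₁, hβ₁, h₁⟩ := hgf
  obtain ⟨α₂, β₂, B₂, hα₂, hBα₂, hβ₂, h₂⟩ := hgB
  obtain ⟨σ, hσ, hσl, hσr⟩ := hα₂.symm
  obtain ⟨δ, hδ, hδl, hδr⟩ := hβ₂.symm
  have hB := hE.le_of_isIso hf hA
  have hA₁ := hβ₁.le_left
  obtain ⟨A₃, hA₃, hAσ⟩ := hσ.restrict hA₁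
  have hBσ : F.IsIso B₂ B σ := by
    refine hσ.restrict_eq hβ₂.le_left ?_
    rw [← hBα₂.image_eq, Set.image_image]
    exact (Set.image_congr fun b hb => hσl b (hB hb)).trans (Set.image_id _)
  refine ⟨σ ∘ α₁, fun x => σ (δ (β₁ (α₂ x))), A₃, hα₁.comp hσ, hAα₁.comp hAσ,
    hE.conj_isIso (hβ₁.comp hδ) hσ le_rfl hA₁ hβ₂.le_left hAσ hBσ fun a ha => ?_, fun a ha => ?_⟩
  · simp only [Function.comp]
    rw [hσr _ (hA₁ ha)]
  · simp only [Function.comp]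
    rw [hσr _ (hα₁.mem (hA ha)), h₁ a ha, Function.comp, ← h₂ _ (hf.mem ha),
      hδl _ (hBα₂.mem (hf.mem ha)), hσl _ (hB (hf.mem ha))]

variable [Fact p.Prime] [Finite F.carrier]

theorem IsNormalSubsystem.factors_of_isFullyNormalized (hP : IsPGroup p F.carrier)
    (hF : F.IsSaturated p) (hE : IsNormalSubsystem p E F) (hA : A ≤ E.carrier)
    (hlt : Nat.card A < Nat.card (E.normalizerIn A)) (hf : F.IsIso A C f)
    (hC : F.IsFullyNormalized C)
    (ih : ∀ N D k, F.IsIso N D k → N ≤ E.carrier → Nat.card A < Nat.card N →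
      Factors E F N D k) : Factors E F A C f := by
  have hCE := hE.le_of_isIso hf hA
  have hCF := hf.le_right
  have hAF := hf.le_left
  have : Finite C := finite_of_le hCF
  obtain ⟨e, he, hef⟩ := id hf
  have hM : E.aut C hCE ≤ F.aut C hCF := fun m hm => hE.isSubsystem.2 _ _ hm
  obtain ⟨γ, hγ, hγA⟩ := FusionSystem.exists_conj_mem
    (((containsConjugates_autBy hP hF hC hCF).inf (isPGroup_autBy hP) hM fun k hk m hm => by
      obtain ⟨k', hk', hki⟩ := isIso_of_aut hk
      obtain ⟨m', hm', hmi⟩ := isIso_of_aut hm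
      obtain ⟨n', hn', -⟩ := isIso_of_aut (mul_mem (mul_mem hk (hM hm)) (inv_mem hk))
      refine IsIso.hom_mem (f := n') ?_ le_rfl hCE _ hn'
      refine hE.conj_isIso hmi hki hCE le_rfl le_rfl hki hki fun a ha => ?_
      have := hn' (k ⟨a, ha⟩)
      rw [MulAut.mul_apply, MulAut.mul_apply, MulAut.inv_apply_self, hk', hm', hk'] at this
      exact this.symm)) inf_le_left e
    (isPGroup_autBy (hP.to_le hE.le_carrier) : IsPGroup p (E.autBy A)) (by
      rintro _ ⟨u, hu, rfl⟩
      obtain ⟨u', hu', hui⟩ := isIso_of_aut (autBy_le_aut hA hu)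
      have hcF := F.comp_mem (F.symm_mem e he)
        (F.comp_mem (hE.isSubsystem.2 _ _ (autBy_le_aut hA hu)) he)
      obtain ⟨n', hn', -⟩ := exists_isIso_of_mem hcF
      refine IsIso.hom_mem (f := n') ?_ le_rfl hCE _ hn'
      refine hE.conj_isIso hui hf hA le_rfl le_rfl hf hf fun a ha => ?_
      rw [← hef ⟨a, ha⟩, ← hn', ← hu' ⟨a, ha⟩, ← hef]
      simp)
  obtain ⟨k, hk, hki⟩ := isIso_of_aut hγ
  have hAN : A ≤ E.normalizerIn A := le_inf hA Subgroup.le_normalizer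
  have hkf := hf.comp (hE.isSubsystem.isIso hki)
  obtain ⟨g, D, hg, hgk⟩ := hF.exists_extension hkf hC hAN
    (inf_le_inf_right _ hE.le_carrier) fun x hx => by
      have hc : A.normalizerMonoidHom ⟨x⁻¹, Subgroup.inv_mem _ hx.2⟩ ∈ E.autBy A :=
        ⟨⟨x⁻¹, _⟩, Subgroup.inv_mem _ hx.1, rfl⟩
      obtain ⟨y, hy, hxy⟩ := hγA _ hc
      refine ⟨y, hy, fun a ha => ?_⟩
      have := hxy ⟨a, ha⟩
      rw [hk, hk, hef, hef] at this
      simpa using this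
  obtain ⟨α, β, N', hα, hNα, hβ, hβα⟩ := ih _ _ g hg inf_le_left hlt
  obtain ⟨A', hA', hAα⟩ := hNα.restrict hAN
  obtain ⟨C', -, hβA⟩ := hβ.restrict hA'
  have hβf : ∀ a ∈ A, (β ∘ α) a = (k ∘ f) a := fun a ha =>
    (hβα a (hAN ha)).trans (hgk a ha)
  obtain rfl : C' = C := (hAα.comp (hE.isSubsystem.isIso hβA)).unique hkf hβf
  obtain ⟨l, hl, hlk, -⟩ := hki.symm
  refine ⟨α, l ∘ β, A', hα, hAα, hβA.comp hl, fun a ha => ?_⟩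
  have := hβf a ha
  simp only [Function.comp] at this ⊢
  rw [this, hlk _ (hf.mem ha)]

theorem IsNormalSubsystem.factors (hP : IsPGroup p F.carrier) (hF : F.IsSaturated p)
    (hE : IsNormalSubsystem p E F) (hf : F.IsIso A B f) (hA : A ≤ E.carrier) :
    Factors E F A B f := by
  induction hn : Nat.card F.carrier - Nat.card A using Nat.strong_induction_on
    generalizing A B f with
  | _ n ih =>
  subst hn
  have ih' : ∀ N D k, F.IsIso N D k → N ≤ E.carrier → Nat.card A < Nat.card N →
      Factors E F N D k := fun N D k hk hN hlt => ih _ (by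
    have := Subgroup.card_le_of_le hk.le_left
    omega) hk hN rfl
  have : Finite E.carrier := finite_of_le hE.le_carrier
  by_cases hcard : Nat.card A = Nat.card E.carrier
  · obtain rfl : A = E.carrier := Subgroup.eq_of_le_of_card_ge hA hcard.ge
    obtain rfl := hf.eq_of_le (hE.le_of_isIso hf hA)
    exact ⟨f, id, _, hf, hf, IsIso.refl le_rfl, fun _ _ => rfl⟩
  have hlt : ∀ X ≤ E.carrier, Nat.card X = Nat.card A →
      Nat.card X < Nat.card (E.normalizerIn X) := by
    intro X hX hXA
    have hle : X ≤ E.normalizerIn X := le_inf hX Subgroup.le_normalizer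
    have : Finite (E.normalizerIn X) := finite_of_le inf_le_left
    by_contra hcon
    have heq := Subgroup.eq_of_le_of_card_ge hle (not_lt.1 hcon)
    refine hcard (hXA ▸ congrArg (fun Y : Subgroup G => Nat.card Y) (le_antisymm hX
      (Subgroup.le_of_forall_mem_normalizer (hP.to_le hE.le_carrier) le_rfl hX
        fun x hx hxn => ?_)))
    rw [heq]
    exact ⟨hx, hxn⟩
  obtain ⟨C, g, hg, hC⟩ := exists_isFullyNormalized hf.le_right
  have hB := hE.le_of_isIso hf hA
  refine hE.factors_of_comp hA hf (g := g) (C := C) ?_ ?_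
  · exact hE.factors_of_isFullyNormalized hP hF hA (hlt A hA rfl) (hf.comp hg) hC ih'
  · exact hE.factors_of_isFullyNormalized hP hF hB (hlt B hB hf.card_eq.symm) hg hC
      (hf.card_eq ▸ ih')

end FusionSystem

/-! ### Normal subgroups of fusion systems -/

namespace FusionSystem

variable {G : Type*} [Group G] {p : ℕ} {E F : FusionSystem G} {A B C R S : Subgroup G}
  {f g h : G → G}

/-- `R` is normal in `F`: every isomorphism `A → B` of `F` extends to an isomorphism
`RA → RB` of `F` that maps `R` to itself. -/
structure IsNormalIn (F : FusionSystem G) (R : Subgroup G) : Prop where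
  le : R ≤ F.carrier
  le_normalizer : F.carrier ≤ Subgroup.normalizer (R : Set G)
  extend : ∀ {A B : Subgroup G} {f : G → G}, F.IsIso A B f →
    ∃ g, F.IsIso (R ⊔ A) (R ⊔ B) g ∧ F.IsIso R R g ∧ ∀ a ∈ A, g a = f a

theorem isNormalIn_of_eq_normalizer (hR : R ≤ F.carrier)
    (h : F.toPrefusionSystem = F.normalizer R) : F.IsNormalIn R := by
  refine ⟨hR, ?_, fun {A B f} hf => ?_⟩
  · have : F.carrier = F.normalizerIn R := congrArg PrefusionSystem.carrier h
    rw [this]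
    exact inf_le_right
  · obtain ⟨e, he, hef⟩ := id hf
    have he' : e.toMonoidHom ∈ (F.normalizer R).Hom A B := h ▸ he
    obtain ⟨-, -, -, φ', hφ', hext, κ, hκ⟩ := he'
    obtain ⟨g, hg, hgi⟩ := exists_isIso_of_mem hφ'
    have hgf : ∀ a ∈ A, g a = f a := fun a ha => by
      rw [← hef ⟨a, ha⟩]
      exact (hg _).symm.trans (hext ⟨a, ha⟩)
    have hκg : ∀ r : R, (κ r : G) = g r := fun r => (hκ r).symm.trans (hg _)
    have hgR : F.IsIso R R g := by
      refine hgi.restrict_eq le_sup_left ?_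
      ext b
      constructor
      · rintro ⟨r, hr, rfl⟩
        exact hκg ⟨r, hr⟩ ▸ (κ ⟨r, hr⟩).2
      · intro hb
        refine ⟨κ⁻¹ ⟨b, hb⟩, Subtype.prop _, ?_⟩
        rw [← hκg, MulAut.apply_inv_self]
    exact ⟨g, hgi.sup le_sup_left le_sup_right hgR (hf.congr fun a ha => (hgf a ha).symm),
      hgR, hgf⟩

theorem IsNormalIn.eq_normalizer (h : F.IsNormalIn S) :
    F.toPrefusionSystem = F.normalizer S := by
  have hc : F.carrier = F.normalizerIn S := (inf_eq_left.2 h.le_normalizer).symm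
  refine PrefusionSystem.ext hc (funext fun A => funext fun B => Set.ext fun φ =>
    ⟨fun hφ => ?_, fun hφ => hφ.2.2.1⟩)
  obtain ⟨hA, hB⟩ := F.le_carrier hφ
  refine ⟨hc ▸ hA, hc ▸ hB, hφ, ?_⟩
  obtain ⟨f, hφf, hf⟩ := exists_isIso_of_mem hφ
  obtain ⟨g, hg, ⟨κ, -, hκ⟩, hgf⟩ := h.extend hf
  have hle : imageSubgroup φ ≤ B := by
    rintro _ ⟨a, rfl⟩
    exact (φ a).2
  obtain ⟨φ', hφ', hφg⟩ := hg.exists_hom (sup_le_sup_left hle S) (sup_le h.le hB)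
  exact ⟨φ', hφ', fun a => (hφg _).trans ((hgf a a.2).trans (hφf a).symm),
    κ, fun r => (hφg _).trans (hκ r).symm⟩

theorem isNormalIn_bot : F.IsNormalIn ⊥ := by
  refine ⟨bot_le, fun x _ => Subgroup.mem_normalizer_iff.2 fun a => by simp, fun {A B f} hf => ?_⟩
  refine ⟨f, by simpa using hf, ?_, fun _ _ => rfl⟩
  refine hf.restrict_eq bot_le ?_
  simp [hf.map_one]

theorem IsNormalIn.sup (hR : F.IsNormalIn R) (hS : F.IsNormalIn S) : F.IsNormalIn (R ⊔ S) := by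
  refine ⟨sup_le hR.le hS.le, ?_, fun {A B f} hf => ?_⟩
  · exact (le_inf hR.le_normalizer hS.le_normalizer).trans
      (Subgroup.normalizer_inf_normalizer_le_normalizer_sup R S)
  · obtain ⟨g, hg, hgS, hgf⟩ := hS.extend hf
    obtain ⟨k, hk, hkR, hkg⟩ := hR.extend hg
    have hkS : F.IsIso S S k :=
      hgS.congr fun s hs => (hkg s (le_sup_left (a := S) (b := A) hs)).symm
    refine ⟨k, by rwa [sup_assoc, sup_assoc],
      hk.sup le_sup_left (le_sup_left.trans le_sup_right) hkR hkS, fun a ha => ?_⟩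
    rw [hkg a (le_sup_right (a := S) (b := A) ha), hgf a ha]

theorem isNormalIn_sSup {s : Set (Subgroup G)} (hs : s.Finite) (h : ∀ T ∈ s, F.IsNormalIn T) :
    F.IsNormalIn (sSup s) := by
  induction s, hs using Set.Finite.induction_on with
  | empty => simpa using isNormalIn_bot
  | insert _ _ ih =>
    rw [sSup_insert]
    exact (h _ (Set.mem_insert _ _)).sup (ih fun T hT => h T (Set.mem_insert_of_mem _ hT))

theorem IsNormalIn.exists_aut (hR : F.IsNormalIn R) (hf : F.IsIso A B f) :
    ∃ g, F.IsIso R R g ∧ ∀ a ∈ A, g a = f a :=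
  let ⟨g, _, hg, hgf⟩ := hR.extend hf
  ⟨g, hg, hgf⟩

variable [Finite F.carrier]

/-- The image of a normal subgroup of `E` under an automorphism of `E.carrier` in `F` is normal. -/
theorem IsNormalSubsystem.isNormalIn_of_isIso (hE : IsNormalSubsystem p E F)
    (hR : E.IsNormalIn R) (hα : F.IsIso E.carrier E.carrier f) (hS : F.IsIso R S f) :
    E.IsNormalIn S := by
  have : Finite R := finite_of_le hS.le_left
  refine ⟨hE.le_of_isIso hS hR.le, fun x hx => ?_, fun {A B k} hk => ?_⟩
  · obtain ⟨y, hy, rfl⟩ := hα.exists_eq hx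
    exact (hα.mem_normalizer hR.le hS hy (hR.le_normalizer hy)).2
  · obtain ⟨σ, hσ, hσl, hσr⟩ := hα.symm
    have hA := hk.le_left
    have hB := hk.le_right
    have hback : ∀ {X Y : Subgroup G}, F.IsIso X Y σ → X ≤ E.carrier → F.IsIso Y X f :=
      fun {X Y} h hX => hα.restrict_eq (hE.le_of_isIso h hX) (by
        rw [← h.image_eq, Set.image_image]
        exact (Set.image_congr fun b hb => hσr b (hX hb)).trans (Set.image_id _))
    obtain ⟨A₀, -, hAσ⟩ := hσ.restrict hA
    obtain ⟨B₀, -, hBσ⟩ := hσ.restrict hB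
    have hA₀ := hback hAσ hA
    have hB₀ := hback hBσ hB
    have hk₀ : E.IsIso A₀ B₀ (σ ∘ k ∘ f) :=
      hE.conj_isIso hk hσ le_rfl hA hB hAσ hBσ fun a ha => by
        simp only [Function.comp]
        rw [hσr a (hA ha)]
    obtain ⟨g, hg, hgR, hgk⟩ := hR.extend hk₀
    have hconj : ∀ {X Y X' Y' : Subgroup G}, E.IsIso X Y g → F.IsIso X X' f → F.IsIso Y Y' f →
        E.IsIso X' Y' (f ∘ g ∘ σ) := fun h hX hY =>
      hE.conj_isIso h hα le_rfl h.le_left h.le_right hX hY fun a ha => by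
        simp only [Function.comp]
        rw [hσl a (h.le_left ha)]
    refine ⟨f ∘ g ∘ σ, hconj hg (hα.sup hR.le (hk₀.le_left) hS hA₀)
      (hα.sup hR.le (hk₀.le_right) hS hB₀), hconj hgR hS hS, fun a ha => ?_⟩
    simp only [Function.comp]
    rw [hgk _ (hAσ.mem ha)]
    simp only [Function.comp]
    rw [hσr a (hA ha), hσr _ (hB (hk.mem ha))]

theorem IsNormalSubsystem.isIso_sSup_conjugates (hE : IsNormalSubsystem p E F)
    (hR : R ≤ E.carrier) (hf : F.IsIso E.carrier E.carrier f) :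
    F.IsIso (sSup {T | F.IsConjugate R T}) (sSup {T | F.IsConjugate R T}) f := by
  have hle : ∀ T, F.IsConjugate R T → T ≤ E.carrier := fun T hT =>
    let ⟨_, hk⟩ := isIso_of_isConjugate hT
    hE.le_of_isIso hk hR
  obtain ⟨S, -, hS⟩ := hf.restrict (sSup_le hle)
  have hfin : Finite S := finite_of_le hS.le_right
  obtain ⟨σ, hσ, -, hσr⟩ := hf.symm
  have : sSup {T | F.IsConjugate R T} = S := by
    refine Subgroup.eq_of_le_of_card_ge (sSup_le fun T hT t ht => ?_) hS.card_eq.ge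
    obtain ⟨T', -, hT'⟩ := hσ.restrict (hle T hT)
    rw [← hσr t (hle T hT ht)]
    refine hS.mem (le_sSup (a := T') ?_ (hT'.mem ht))
    exact isConjugate_trans hT hT'.isConjugate
  exact this ▸ hS

variable [Fact p.Prime]

/-- An `F`-conjugate of a normal subgroup of `E` is normal in `E`. -/
theorem IsNormalSubsystem.isNormalIn_of_isConjugate (hP : IsPGroup p F.carrier)
    (hF : F.IsSaturated p) (hE : IsNormalSubsystem p E F) (hR : E.IsNormalIn R)
    (hS : F.IsConjugate R S) : E.IsNormalIn S := by
  obtain ⟨f, hf⟩ := isIso_of_isConjugate hS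
  obtain ⟨α, β, T, hα, hRα, hβ, -⟩ := hE.factors hP hF hf hR.le
  have hT := hE.isNormalIn_of_isIso hR hα hRα
  obtain ⟨g, hg, hgβ⟩ := hT.exists_aut hβ
  exact hg.unique hβ hgβ ▸ hT

theorem IsNormalSubsystem.isNormalIn_sSup_conjugates (hP : IsPGroup p F.carrier)
    (hF : F.IsSaturated p) (hE : IsNormalSubsystem p E F) (hR : E.IsNormalIn R) :
    E.IsNormalIn (sSup {T | F.IsConjugate R T}) := by
  refine isNormalIn_sSup ?_ fun T hT => hE.isNormalIn_of_isConjugate hP hF hR hT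
  have hfin : (F.carrier : Set G).Finite := Set.toFinite _
  refine Set.Finite.of_finite_image (f := fun T : Subgroup G => (T : Set G))
    (hfin.finite_subsets.subset ?_) SetLike.coe_injective.injOn
  rintro _ ⟨T, hT, rfl⟩
  exact (F.le_carrier hT.choose_spec).2

/-- Let `S` be normal in `E` and invariant under all automorphisms of `E.carrier` in `F`. Then
every subgroup of `S` that is invariant under the automorphisms of `S` in `F` is strongly closed. -/
theorem IsNormalSubsystem.isStronglyClosed_of_aut (hP : IsPGroup p F.carrier)
    (hF : F.IsSaturated p) (hE : IsNormalSubsystem p E F) (hS : E.IsNormalIn S)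
    (hSα : ∀ α, F.IsIso E.carrier E.carrier α → F.IsIso S S α) {D : Subgroup G} (hD : D ≤ S)
    (hDα : ∀ α, F.IsIso S S α → ∀ d ∈ D, α d ∈ D) : F.IsStronglyClosed D := by
  refine isStronglyClosed_iff.2 ⟨hD.trans (hS.le.trans hE.le_carrier), fun A B f hf hA b hb => ?_⟩
  obtain ⟨a, ha, rfl⟩ := hf.exists_eq hb
  obtain ⟨α, β, T, hα, hAα, hβ, hβα⟩ := hE.factors hP hF hf (hA.trans (hD.trans hS.le))
  obtain ⟨g, hg, hgβ⟩ := hS.exists_aut hβ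
  rw [← hβα a ha, ← hgβ _ (hAα.mem ha)]
  exact hDα g (hE.isSubsystem.isIso hg) _ (hDα α (hSα α hα) a (hA ha))

end FusionSystem

/-! ### Normality of strongly closed subgroups with a strongly closed central series -/

namespace FusionSystem

variable {G : Type*} [Group G] {p : ℕ} {E F : FusionSystem G} {A B C R S : Subgroup G}
  {f g h : G → G} {D : ℕ → Subgroup G}

/-- The automorphisms of `C` in `F` that stabilize the chain of intersections of `C` with the
members of a chain of strongly closed subgroups. -/
def chainStabilizer (F : FusionSystem G) (hD : ∀ i, F.IsStronglyClosed (D i))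
    (hC : C ≤ F.carrier) : Subgroup (MulAut C) where
  carrier := {u | u ∈ F.aut C hC ∧ ∀ i, ∀ c : C, (c : G) ∈ D (i + 1) → (c : G)⁻¹ * u c ∈ D i}
  one_mem' := ⟨one_mem _, fun i c _ => by simp⟩
  mul_mem' := by
    rintro u v ⟨hu, hu'⟩ ⟨hv, hv'⟩
    refine ⟨mul_mem hu hv, fun i c hc => ?_⟩
    obtain ⟨k, hk, hki⟩ := isIso_of_aut hv
    have hvc : (v c : G) ∈ D (i + 1) := hk c ▸ (hD _).mem hki c.2 hc
    have := mul_mem (hv' i c hc) (hu' i (v c) hvc)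
    rwa [mul_assoc, mul_inv_cancel_left] at this
  inv_mem' := by
    rintro u ⟨hu, hu'⟩
    refine ⟨inv_mem hu, fun i c hc => ?_⟩
    obtain ⟨k, hk, hki⟩ := isIso_of_aut (inv_mem hu)
    have := inv_mem (hu' i (u⁻¹ c) (hk c ▸ (hD _).mem hki c.2 hc))
    simpa using this

theorem chainStabilizer_le (hD : ∀ i, F.IsStronglyClosed (D i)) (hC : C ≤ F.carrier) :
    F.chainStabilizer hD hC ≤ F.aut C hC :=
  fun _ hu => hu.1

theorem conj_mem_chainStabilizer (hD : ∀ i, F.IsStronglyClosed (D i)) (hC : C ≤ F.carrier)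
    {u γ : MulAut C} (hu : u ∈ F.chainStabilizer hD hC) (hγ : γ ∈ F.aut C hC) :
    γ⁻¹ * u * γ ∈ F.chainStabilizer hD hC := by
  refine ⟨mul_mem (mul_mem (inv_mem hγ) hu.1) hγ, fun i c hc => ?_⟩
  obtain ⟨k, hk, hki⟩ := isIso_of_aut hγ
  obtain ⟨l, hl, hli⟩ := isIso_of_aut (inv_mem hγ)
  have h := hu.2 i (γ c) (hk c ▸ (hD _).mem hki c.2 hc)
  have h' := (hD i).mem hli ((γ c)⁻¹ * u (γ c) : C).2 h
  rw [← hl] at h'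
  simpa using h'

theorem isPGroup_chainStabilizer [Fact p.Prime] [Finite F.carrier] (hP : IsPGroup p F.carrier)
    (hD : ∀ i, F.IsStronglyClosed (D i)) (hC : C ≤ F.carrier) (h0 : D 0 = ⊥) {m : ℕ}
    (hm : D m = F.carrier) : IsPGroup p (F.chainStabilizer hD hC) := by
  have : Finite C := finite_of_le hC
  obtain ⟨k, hk⟩ := IsPGroup.iff_card.1 (hP.to_le hC)
  have hpow : ∀ c : C, c ^ p ^ k = 1 := fun c => hk ▸ pow_card_eq_one'
  rintro ⟨u, hu⟩
  have key : ∀ i, ∀ c : C, (c : G) ∈ D i → (u ^ p ^ (k * i)) c = c := by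
    intro i
    induction i with
    | zero =>
      intro c hc
      rw [h0, Subgroup.mem_bot, OneMemClass.coe_eq_one] at hc
      rw [hc, map_one]
    | succ i ih =>
      intro c hc
      have hw := (pow_mem hu (p ^ (k * i)) : u ^ p ^ (k * i) ∈ F.chainStabilizer hD hC).2 i c hc
      have hz := ih (c⁻¹ * (u ^ p ^ (k * i)) c) hw
      rw [mul_add, mul_one, pow_add, pow_mul]
      set w := u ^ p ^ (k * i)
      have hj : ∀ j : ℕ, (w ^ j) c = c * (c⁻¹ * w c) ^ j := by
        intro j
        induction j with
        | zero => simp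
        | succ j ihj =>
          rw [pow_succ', MulAut.mul_apply, ihj, map_mul, map_pow, hz, pow_succ', ← mul_assoc c,
            mul_inv_cancel_left]
      rw [hj, hpow, mul_one]
  refine ⟨k * m, Subtype.ext (MulEquiv.ext fun c => ?_)⟩
  exact key m c (hm ▸ hC c.2)

theorem chainStabilizer_le_autBy [Fact p.Prime] [Finite F.carrier] (hP : IsPGroup p F.carrier)
    (hF : F.IsSaturated p) (hD : ∀ i, F.IsStronglyClosed (D i)) (hC : C ≤ F.carrier)
    (hfn : F.IsFullyNormalized C) (h0 : D 0 = ⊥) {m : ℕ} (hm : D m = F.carrier) :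
    F.chainStabilizer hD hC ≤ F.autBy C := by
  obtain ⟨γ, hγ, h⟩ := containsConjugates_autBy hP hF hfn hC _ (chainStabilizer_le hD hC)
    (isPGroup_chainStabilizer hP hD hC h0 hm)
  intro u hu
  have := h _ (conj_mem_chainStabilizer hD hC hu hγ)
  rwa [show γ * (γ⁻¹ * u * γ) * γ⁻¹ = u by group] at this

theorem _root_.PrefusionSystem.IsStronglyClosed.isIso_sup [Finite S] (hS : F.IsStronglyClosed S) {T : Subgroup G}
    (hf : F.IsIso A B f) (hg : F.IsIso (S ⊔ A) T g) (hfg : ∀ a ∈ A, g a = f a) :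
    F.IsIso S S g ∧ F.IsIso (S ⊔ A) (S ⊔ B) g := by
  obtain ⟨S', -, hS'⟩ := hg.restrict (le_sup_left : S ≤ S ⊔ A)
  obtain rfl := hS'.eq_of_le ((isStronglyClosed_iff.1 hS).2 _ _ _ hS' le_rfl)
  exact ⟨hS', hg.sup le_sup_left le_sup_right hS' (hf.congr fun a ha => (hfg a ha).symm)⟩

section

variable [Fact p.Prime] [Finite F.carrier] (hP : IsPGroup p F.carrier) (hF : F.IsSaturated p)
  (hS : F.IsStronglyClosed S) (hD : ∀ i, F.IsStronglyClosed (D i)) (h0 : D 0 = ⊥) {m : ℕ}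
  (hm : D m = F.carrier)
  (hSD : ∀ i, ∀ x ∈ S, ∀ d ∈ D (i + 1), d⁻¹ * x⁻¹ * d * x ∈ D i)

include hP hF hD h0 hm hSD in
theorem exists_extension_inf_normalizer (hSc : S ≤ F.carrier) (hf : F.IsIso A C f)
    (hC : F.IsFullyNormalized C) :
    ∃ g B, F.IsIso (A ⊔ S ⊓ Subgroup.normalizer (A : Set G)) B g ∧ ∀ a ∈ A, g a = f a := by
  refine hF.exists_extension_sup hf hC (inf_le_inf_right _ hSc) fun x hx => ?_
  have hAc := hf.le_left
  obtain ⟨e, he, hef⟩ := id hf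
  obtain ⟨l, hl, hlf, hfl⟩ := hf.symm
  let c : MulAut A := A.normalizerMonoidHom ⟨x⁻¹, Subgroup.inv_mem _ hx.2⟩
  have hc : ∀ a : A, (c a : G) = x⁻¹ * a * x := fun a => by simp [c]
  have hcA : c ∈ F.autBy A := mem_autBy.2 ⟨x, ⟨hSc hx.1, hx.2⟩, hc⟩
  have hκ : (MulAut.congr e) c ∈ F.chainStabilizer hD hf.le_right := by
    refine ⟨F.comp_mem (F.symm_mem e he) (F.comp_mem (autBy_le_aut hAc hcA) he),
      fun i b hb => ?_⟩
    obtain ⟨a, rfl⟩ := e.surjective b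
    have ha : (a : G) ∈ D (i + 1) := by
      have := (hD _).mem hl (e a).2 hb
      rwa [hef, hlf a a.2] at this
    have h1 : ((a⁻¹ * c a : A) : G) ∈ D i := by
      have := hSD i x hx.1 a ha
      rwa [Subgroup.coe_mul, hc, Subgroup.coe_inv, ← mul_assoc, ← mul_assoc]
    have h2 := (hD i).mem hf (a⁻¹ * c a : A).2 h1
    rw [← hef] at h2
    simpa [MulAut.congr] using h2
  obtain ⟨y, hy, h⟩ := mem_autBy.1
    (chainStabilizer_le_autBy hP hF hD hf.le_right hC h0 hm hκ)
  refine ⟨y, hy, fun a ha => ?_⟩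
  have := h (e ⟨a, ha⟩)
  rw [hef ⟨a, ha⟩] at this
  rw [← this]
  simp [MulAut.congr, hef, hc]

include hP hF hS hD h0 hm hSD in
theorem exists_extension_sup_of_chain (hf : F.IsIso A B f) :
    ∃ g T, F.IsIso (S ⊔ A) T g ∧ ∀ a ∈ A, g a = f a := by
  induction hn : Nat.card F.carrier - Nat.card A using Nat.strong_induction_on
    generalizing A B f with
  | _ n ih =>
  subst hn
  have : Finite S := finite_of_le hS.1
  have key : ∀ {X C : Subgroup G} {k : G → G}, F.IsIso X C k → F.IsFullyNormalized C →
      Nat.card X = Nat.card A → ∃ g T, F.IsIso (S ⊔ X) T g ∧ ∀ a ∈ X, g a = k a := by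
    intro X C k hk hC hcard
    by_cases hSX : S ≤ X
    · exact ⟨k, C, by rwa [sup_eq_right.2 hSX], fun _ _ => rfl⟩
    obtain ⟨g, T, hg, hgk⟩ := exists_extension_inf_normalizer hP hF hD h0 hm hSD hS.1 hk hC
    have hfin := finite_of_le hg.le_left
    have hlt : Nat.card X < Nat.card ↥(X ⊔ S ⊓ Subgroup.normalizer (X : Set G)) := by
      by_contra hcon
      have heq := Subgroup.eq_of_le_of_card_ge le_sup_left (not_lt.1 hcon)
      have hle : S ⊓ Subgroup.normalizer (X : Set G) ≤ X := sup_eq_left.1 heq.symm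
      refine hSX (le_sup_left.trans (Subgroup.le_of_forall_mem_normalizer (B := S ⊔ X) hP
        (sup_le hS.1 hk.le_left) le_sup_right fun x hx hxn => ?_))
      have hx' : x ∈ ((S ⊔ X : Subgroup G) : Set G) := hx
      rw [Subgroup.coe_mul_of_right_le_normalizer_left _ _
        (hk.le_left.trans hS.le_normalizer)] at hx'
      obtain ⟨s, hs, t, ht, rfl⟩ := hx'
      have hsn := mul_mem hxn (Subgroup.inv_mem _ (Subgroup.le_normalizer ht))
      rw [mul_inv_cancel_right] at hsn
      exact mul_mem (hle ⟨hs, hsn⟩) ht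
    obtain ⟨g', T', hg', hgg⟩ := ih _ (by
      have := Subgroup.card_le_of_le hg.le_left
      omega) hg rfl
    refine ⟨g', T', ?_, fun a ha => ?_⟩
    · rwa [← sup_assoc, sup_eq_left.2 (inf_le_left.trans le_sup_left)] at hg'
    · rw [hgg a (Subgroup.mem_sup_left ha), hgk a ha]
  obtain ⟨C, k, hk, hC⟩ := exists_isFullyNormalized hf.le_right
  obtain ⟨g₁, T₁, hg₁, h₁⟩ := key (hf.comp hk) hC rfl
  obtain ⟨g₂, T₂, hg₂, h₂⟩ := key hk hC hf.card_eq.symm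
  obtain ⟨l, hl, hlg, -⟩ := (hS.isIso_sup hk hg₂ h₂).2.symm
  refine ⟨l ∘ g₁, _, (hS.isIso_sup (hf.comp hk) hg₁ h₁).2.comp hl, fun a ha => ?_⟩
  rw [Function.comp, h₁ a ha, Function.comp, ← h₂ _ (hf.mem ha),
    hlg _ (Subgroup.mem_sup_right (hf.mem ha))]

include hP hF hS hD h0 hm hSD in
/-- A strongly closed subgroup `S` is normal if `S` centralizes the factors of a chain of strongly
closed subgroups leading from the trivial group to the whole group. -/
theorem isNormalIn_of_chain : F.IsNormalIn S := by
  refine ⟨hS.1, hS.le_normalizer, fun {A B f} hf => ?_⟩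
  have : Finite S := finite_of_le hS.1
  obtain ⟨g, T, hg, hgf⟩ := exists_extension_sup_of_chain hP hF hS hD h0 hm hSD hf
  obtain ⟨h1, h2⟩ := hS.isIso_sup hf hg hgf
  exact ⟨g, h2, h1, hgf⟩

end

theorem IsIso.mem_map_of_characteristic (hf : F.IsIso S S f) (K : Subgroup S)
    [hK : K.Characteristic] {d : G} (hd : d ∈ K.map S.subtype) : f d ∈ K.map S.subtype := by
  obtain ⟨e, -, hef⟩ := hf
  obtain ⟨x, hx, rfl⟩ := hd
  exact ⟨e x, Subgroup.characteristic_iff_le_comap.1 hK e hx, hef x⟩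

theorem IsNormalSubsystem.isNormalIn_of_forall_isIso [Fact p.Prime] [Finite F.carrier]
    (hP : IsPGroup p F.carrier) (hF : F.IsSaturated p) (hE : IsNormalSubsystem p E F)
    (hS : E.IsNormalIn S)
    (hSα : ∀ α, F.IsIso E.carrier E.carrier α → F.IsIso S S α) : F.IsNormalIn S := by
  have hSc : S ≤ F.carrier := hS.le.trans hE.le_carrier
  have : Finite S := finite_of_le hSc
  have := (hP.to_le hSc).isNilpotent
  obtain ⟨n, hn⟩ := Group.IsNilpotent.nilpotent S
  have hmap : ∀ i, (Subgroup.upperCentralSeries S i).map S.subtype ≤ S := fun i =>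
    Subgroup.map_subtype_le _
  have hZ : ∀ i, F.IsStronglyClosed ((Subgroup.upperCentralSeries S i).map S.subtype) := fun i =>
    hE.isStronglyClosed_of_aut hP hF hS hSα (hmap i) fun α hα d hd =>
      hα.mem_map_of_characteristic _ hd
  have htop : (Subgroup.upperCentralSeries S n).map S.subtype = S := by
    rw [hn, ← MonoidHom.range_eq_map, Subgroup.range_subtype]
  have hSs : F.IsStronglyClosed S := htop ▸ hZ n
  let D : ℕ → Subgroup G := fun i =>
    if i ≤ n then (Subgroup.upperCentralSeries S i).map S.subtype else F.carrier
  refine isNormalIn_of_chain (D := D) (m := n + 1) hP hF hSs (fun i => ?_) ?_ ?_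
    fun i x hx d hd => ?_
  · by_cases hi : i ≤ n
    · simpa only [D, if_pos hi] using hZ i
    · simp only [D, if_neg hi]
      exact isStronglyClosed_iff.2 ⟨le_rfl, fun _ _ _ hf _ => hf.le_right⟩
  · simp [D]
  · simp [D]
  · by_cases hi : i + 1 ≤ n
    · simp only [D, if_pos hi, if_pos (Nat.le_of_succ_le hi)] at hd ⊢
      obtain ⟨z, hz, rfl⟩ := hd
      refine ⟨_, Subgroup.mem_upperCentralSeries_succ_iff.1 (inv_mem hz) (⟨x, hx⟩ : S)⁻¹, ?_⟩
      simp [commutatorElement_def]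
    · simp only [D, if_neg hi] at hd
      by_cases hi' : i ≤ n
      · obtain rfl : i = n := by omega
        simp only [D, if_pos le_rfl, htop]
        exact mul_mem ((Subgroup.mem_normalizer_iff''.1 (hSs.le_normalizer hd) _).1
          (inv_mem hx)) hx
      · simp only [D, if_neg hi']
        exact mul_mem (mul_mem (mul_mem (inv_mem hd) (inv_mem (hSc hx))) hd) (hSc hx)

end FusionSystem

theorem theoremB {G : Type*} [Group G] (p : ℕ) [Fact p.Prime] (F E : FusionSystem G)
    [Finite F.carrier] (hP : IsPGroup p F.carrier) (hF : F.IsSaturated p)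
    (hE : FusionSystem.IsNormalSubsystem p E F)
    (R : Subgroup G) (hRQ : R ≤ E.carrier)
    (hR : E.toPrefusionSystem = E.normalizer R) :
    F.toPrefusionSystem = F.normalizer (sSup {T : Subgroup G | F.IsConjugate R T}) := by
  have hRn := FusionSystem.isNormalIn_of_eq_normalizer hRQ hR
  exact (hE.isNormalIn_of_forall_isIso hP hF (hE.isNormalIn_sSup_conjugates hP hF hRn)
    fun _ hα => hE.isIso_sSup_conjugates hRQ hα).eq_normalizer
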